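/- Let $1\le m\le n$ and let $X\subset\mathbb C^n$ be compact. Let $\beta=\frac i2\sum_j dz_j\wedge d\bar z_j$, and let $\Gamma_m$ be the set of real $(1,1)$-forms $\alpha$ with constant coefficients such that $\alpha^k\wedge\beta^{n-k}\ge 0$ for $1\le k\le m$. A function $u$ on an open set $U\subset\mathbb C^n$ is called $m$-subharmonic if it is subharmonic and $dd^cu\wedge\alpha_1\wedge\dots\wedge\alpha_{m-1}\wedge\beta^{n-m}\ge 0$ in the sense of currents on $U$ for all $\alpha_1,\dots,\alpha_{m-1}\in\Gamma_m$. Let $\mathcal{SH}_m^o(X)$ be the set of restrictions to $X$ of real-valued functions that are continuous and $m$-subharmonic on some open neighbourhood of $X$. For $z\in X$ let $\mathcal J_z^m(X)$ be the set of regular Borel probability measures $\mu$ on $X$ with $$u(z)\le\int_X u\,d\mu\qquad\text{for all }u\in\mathcal{SH}_m^o(X).$$ The Choquet boundary of $X$ is $O_X^m=\{z\in X:\mathcal J_z^m(X)=\{\delta_z\}\}$, and the Šilov boundary $B_X^m$ is the closure of $O_X^m$. For $z\in X$ and $E\subseteq X$ the $m$-harmonic measure of $E$ is $$\omega(z,E,X)=\inf_{V\supseteq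 E,\ V\text{ open}}\ \sup_{\mu\in\mathcal J_z^m(X)}\mu(V).$$ Theorem. The Šilov boundary $B_X^m$ is the smallest closed set $E\subseteq X$ such that $\omega(z,E,X)=1$ for every $z\in X$. That is, $B_X^m$ is closed and $\omega(z,B_X^m,X)=1$ for every $z\in X$, and $B_X^m\subseteq E$ for every closed $E\subseteq X$ with $\omega(z,E,X)=1$ for all $z\in X$. -/

import Mathlib

open MeasureTheory
open scoped ContDiff ENNReal

noncomputable section

namespace MSubharmonic

/-- Complex Euclidean space of dimension `n`. -/
abbrev CSpace (n : ℕ) : Type := EuclideanSpace ℂ (Fin n)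

/-- The mixed discriminant of `n` complex `n × n` matrices, i.e. the polarisation of the determinant.
If `αᵢ = (i/2) ∑ⱼₖ (A i)ⱼₖ dzⱼ ∧ dz̄ₖ`, then `α₁ ∧ ⋯ ∧ αₙ = n! • mixedDisc A • dV`, where `dV` is the
Euclidean volume form on `ℂⁿ`. -/
def mixedDisc {n : ℕ} (A : Fin n → Matrix (Fin n) (Fin n) ℂ) : ℂ :=
  ((n.factorial : ℂ))⁻¹ *
    ∑ σ : Equiv.Perm (Fin n), (Matrix.of fun i j : Fin n => A (σ i) i j).det

/-- The closed cone `Γ_m` of real `(1,1)`-forms `α` with constant coefficients, identified with their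
Hermitian coefficient matrices, such that `α ^ k ∧ β ^ (n - k) ≥ 0` for `1 ≤ k ≤ m`, where
`β` is the standard Kähler form (whose coefficient matrix is the identity). -/
def Gam (n m : ℕ) : Set (Matrix (Fin n) (Fin n) ℂ) :=
  {A | A.IsHermitian ∧
    ∀ k : ℕ, 1 ≤ k → k ≤ m → 0 ≤ (mixedDisc fun i : Fin n => if (i : ℕ) < k then A else 1).re}

/-- The second directional derivative `∂_v ∂_w φ (z)` over the reals. -/
def dirDeriv₂ {n : ℕ} (φ : CSpace n → ℝ) (v w z : CSpace n) : ℝ :=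
  fderiv ℝ (fun y => fderiv ℝ φ y w) z v

/-- The complex Hessian `(∂²φ / ∂zⱼ ∂z̄ₖ)ⱼₖ` of a real-valued function, where
`∂/∂zⱼ = (∂/∂xⱼ - i ∂/∂yⱼ) / 2` and `∂/∂z̄ₖ = (∂/∂xₖ + i ∂/∂yₖ) / 2`. -/
def complexHessian {n : ℕ} (φ : CSpace n → ℝ) (z : CSpace n) : Matrix (Fin n) (Fin n) ℂ :=
  Matrix.of fun j k =>
    let ex : Fin n → CSpace n := fun l => EuclideanSpace.single l 1
    let ey : Fin n → CSpace n := fun l => EuclideanSpace.single l Complex.I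
    (1 / 4 : ℂ) *
      (((dirDeriv₂ φ (ex j) (ex k) z + dirDeriv₂ φ (ey j) (ey k) z : ℝ) : ℂ) +
        Complex.I * ((dirDeriv₂ φ (ex j) (ey k) z - dirDeriv₂ φ (ey j) (ex k) z : ℝ) : ℂ))

/-- The density (up to a positive factor depending only on `n`) of the top-degree form
`dd^c φ ∧ α₁ ∧ ⋯ ∧ α_{m-1} ∧ β ^ (n - m)`; only `α i` with `1 ≤ i < m` occur. -/
def hessianDensity {n : ℕ} (m : ℕ) (α : Fin n → Matrix (Fin n) (Fin n) ℂ)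
    (φ : CSpace n → ℝ) (z : CSpace n) : ℝ :=
  (mixedDisc fun i : Fin n =>
    if (i : ℕ) = 0 then complexHessian φ z else if (i : ℕ) < m then α i else 1).re

/-- A real-valued function is subharmonic on the open set `U` of `ℂⁿ = ℝ²ⁿ`: it is upper
semicontinuous, locally integrable, and satisfies the sub-mean value inequality on balls. -/
structure IsSubharmonicOn {n : ℕ} (u : CSpace n → ℝ) (U : Set (CSpace n)) : Prop where
  usc : UpperSemicontinuousOn u U
  locInt : LocallyIntegrableOn u U volume
  submean : ∀ (a : CSpace n) (r : ℝ), 0 < r → Metric.closedBall a r ⊆ U →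
    u a ≤ ⨍ x in Metric.ball a r, u x

/-- A real-valued function is `m`-subharmonic on the open set `U` of `ℂⁿ`, `1 ≤ m ≤ n`: it is
subharmonic, and `dd^c u ∧ α₁ ∧ ⋯ ∧ α_{m-1} ∧ β ^ (n - m) ≥ 0` in the sense of currents on `U`
for all `α₁, …, α_{m-1} ∈ Γ_m`. -/
structure IsMSubharmonicOn {n : ℕ} (m : ℕ) (u : CSpace n → ℝ) (U : Set (CSpace n)) : Prop where
  subharmonic : IsSubharmonicOn u U
  current_nonneg : ∀ α : Fin n → Matrix (Fin n) (Fin n) ℂ, (∀ i, α i ∈ Gam n m) →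
    ∀ φ : CSpace n → ℝ, ContDiff ℝ ∞ φ → HasCompactSupport φ → tsupport φ ⊆ U → (∀ z, 0 ≤ φ z) →
      0 ≤ ∫ z, u z * hessianDensity m α φ z

/-- `SH_m^o(X)`: the restrictions to `X` of functions that are `m`-subharmonic and continuous on
some open neighbourhood of `X`. -/
def SHo {n : ℕ} (m : ℕ) (X : Set (CSpace n)) : Set (X → ℝ) :=
  {f | ∃ (U : Set (CSpace n)) (u : CSpace n → ℝ), IsOpen U ∧ X ⊆ U ∧
    IsMSubharmonicOn m u U ∧ ContinuousOn u U ∧ ∀ x : X, f x = u x}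

/-- `J_z^m(X)`: the Jensen measures on `X` with barycenter `z`, i.e. the regular Borel probability
measures `μ` on `X` with `u z ≤ ∫ u dμ` for all `u ∈ SH_m^o(X)`. -/
def jensen {n : ℕ} (m : ℕ) (X : Set (CSpace n)) (z : X) : Set (Measure X) :=
  {μ | μ.Regular ∧ IsProbabilityMeasure μ ∧ ∀ u ∈ SHo m X, u z ≤ ∫ x, u x ∂μ}

/-- The Choquet boundary `O_X^m`, as a subset of `X`. -/
def choquetBoundary {n : ℕ} (m : ℕ) (X : Set (CSpace n)) : Set X :=
  {z | jensen m X z = {Measure.dirac z}}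

/-- The Šilov boundary `B_X^m`: the closure of the Choquet boundary. The closure is taken in `X`,
which for compact `X` is the closure in `ℂⁿ`. -/
def silovBoundary {n : ℕ} (m : ℕ) (X : Set (CSpace n)) : Set X :=
  closure (choquetBoundary m X)

/-- The `m`-harmonic measure `ω(z, E, X) = inf_{V ⊇ E open} sup_{μ ∈ J_z^m(X)} μ(V)`. -/
def harmonicMeasure {n : ℕ} (m : ℕ) (X : Set (CSpace n)) (z : X) (E : Set X) : ℝ≥0∞ :=
  ⨅ V : Set X, ⨅ _ : IsOpen V ∧ E ⊆ V, ⨆ μ ∈ jensen m X z, μ V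

end MSubharmonic

end

/-! The cone `SHo m X` contains the real-affine functions, hence the constants and enough functions
to separate points, and Choquet theory applies. Minimality: at a Choquet point `z` the only Jensen
measure is the Dirac mass, so if `z ∉ E` the open set `{z}ᶜ` forces harmonic measure 0; closedness
of `E` then gives the closure. For the boundary `B` itself, call a set absorbing if it carries every
Jensen measure of each of its points. Argmax sets of cone functions on closed absorbing sets are
again closed and absorbing; maximising successively over the real coordinates shrinks one to a
point, which is a Choquet point. So every cone function attains its maximum on the Choquet boundary
(`exists_mem_choquetBoundary_forall_le`). This bounds the envelope `upperEnvelope`, a sublinear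
functional that sees only values on `B`; Hahn–Banach and Riesz–Markov turn it into a Jensen measure
carried by `B` (`exists_mem_jensen_compl_eq_zero`), which gives every open `V ⊇ B` mass 1. -/

namespace MSubharmonic

variable {n m : ℕ}

/-! ### Linearity of the Hessian density in the second derivatives -/

theorem complexHessian_re (φ : CSpace n → ℝ) (z : CSpace n) (j k : Fin n) :
    (complexHessian φ z j k).re = (1 / 4) *
      (dirDeriv₂ φ (EuclideanSpace.single j 1) (EuclideanSpace.single k 1) z +
        dirDeriv₂ φ (EuclideanSpace.single j Complex.I) (EuclideanSpace.single k Complex.I) z) := by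
  have : (1 / 4 : ℂ) = ((1 / 4 : ℝ) : ℂ) := by norm_num
  simp only [complexHessian, Matrix.of_apply, this, Complex.re_ofReal_mul]
  simp

theorem complexHessian_im (φ : CSpace n → ℝ) (z : CSpace n) (j k : Fin n) :
    (complexHessian φ z j k).im = (1 / 4) *
      (dirDeriv₂ φ (EuclideanSpace.single j 1) (EuclideanSpace.single k Complex.I) z -
        dirDeriv₂ φ (EuclideanSpace.single j Complex.I) (EuclideanSpace.single k 1) z) := by
  have : (1 / 4 : ℂ) = ((1 / 4 : ℝ) : ℂ) := by norm_num
  simp only [complexHessian, Matrix.of_apply, this, Complex.im_ofReal_mul]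
  simp

/-- The mixed discriminant is a linear function of the matrix in a given slot. -/
theorem exists_mixedDisc_eq_sum (i₀ : Fin n) (B : Fin n → Matrix (Fin n) (Fin n) ℂ) :
    ∃ c : Fin n → Fin n → ℂ, ∀ H : Matrix (Fin n) (Fin n) ℂ,
      mixedDisc (Function.update B i₀ H) = ∑ j, ∑ k, c j k * H j k := by
  classical
  have key : ∀ σ : Equiv.Perm (Fin n), ∃ c : Fin n → ℂ, ∀ H : Matrix (Fin n) (Fin n) ℂ,
      (Matrix.of fun i j : Fin n => Function.update B i₀ H (σ i) i j).det
        = ∑ k, c k * H (σ.symm i₀) k := by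
    intro σ
    set M : Matrix (Fin n) (Fin n) ℂ := Matrix.of fun i j => B (σ i) i j
    -- The coefficients are cofactors: determinants with the row in question replaced by a basis
    -- vector.
    refine ⟨fun k => (M.updateRow (σ.symm i₀) (Pi.single k 1)).det, fun H => ?_⟩
    have h1 : (Matrix.of fun i j : Fin n => Function.update B i₀ H (σ i) i j)
        = M.updateRow (σ.symm i₀) (H (σ.symm i₀)) := by
      ext i j
      by_cases hi : i = σ.symm i₀
      · subst hi; simp
      · have : σ i ≠ i₀ := fun h => hi (by simp [← h])
        simp [Matrix.updateRow_ne hi, Function.update_of_ne this, M]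
    rw [h1]
    let L : (Fin n → ℂ) →ₗ[ℂ] ℂ :=
      { toFun := fun v => (M.updateRow (σ.symm i₀) v).det
        map_add' := fun v w => Matrix.det_updateRow_add M _ v w
        map_smul' := fun s v => Matrix.det_updateRow_smul M _ s v }
    have h2 := L.pi_apply_eq_sum_univ (H (σ.symm i₀))
    refine h2.trans (Finset.sum_congr rfl fun k _ => ?_)
    have hk : (fun j => if k = j then (1 : ℂ) else 0) = Pi.single k 1 := by
      ext j; simp [Pi.single_apply, eq_comm]
    rw [smul_eq_mul, mul_comm, hk]
    rfl
  choose c hc using key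
  refine ⟨fun j k => (n.factorial : ℂ)⁻¹ * ∑ σ : Equiv.Perm (Fin n),
    if σ.symm i₀ = j then c σ k else 0, fun H => ?_⟩
  simp only [mixedDisc, hc, mul_assoc, Finset.sum_mul, ← Finset.mul_sum]
  congr 1
  symm
  rw [Finset.sum_congr rfl fun j _ => Finset.sum_comm, Finset.sum_comm]
  refine Finset.sum_congr rfl fun σ _ => ?_
  rw [Finset.sum_comm]
  simp

/-- The density is a real-linear combination of second derivatives, with coefficients that do not
depend on the function. -/
theorem exists_hessianDensity_eq_sum (hn : 0 < n) (m : ℕ)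
    (α : Fin n → Matrix (Fin n) (Fin n) ℂ) :
    ∃ a b : Fin n → Fin n → ℝ, ∀ (φ : CSpace n → ℝ) (z : CSpace n),
      hessianDensity m α φ z = ∑ j, ∑ k,
        (a j k * (complexHessian φ z j k).re + b j k * (complexHessian φ z j k).im) := by
  obtain ⟨c, hc⟩ := exists_mixedDisc_eq_sum ⟨0, hn⟩
    (fun i : Fin n => if (i : ℕ) < m then α i else 1)
  refine ⟨fun j k => (c j k).re, fun j k => -(c j k).im, fun φ z => ?_⟩
  have : (fun i : Fin n =>
      if (i : ℕ) = 0 then complexHessian φ z else if (i : ℕ) < m then α i else 1) =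
      Function.update (fun i : Fin n => if (i : ℕ) < m then α i else 1) ⟨0, hn⟩
        (complexHessian φ z) := by
    ext1 i
    by_cases hi : i = ⟨0, hn⟩
    · subst hi; simp
    · rw [Function.update_of_ne hi, if_neg fun h => hi (Fin.ext h)]
  rw [hessianDensity, this, hc]
  simp [Complex.mul_re, sub_eq_add_neg]

/-! ### Integration of test-function Hessians against affine functions -/

section TestFunctions

variable {φ : CSpace n → ℝ}

theorem contDiff_fderiv_apply (hφ : ContDiff ℝ ∞ φ) (w : CSpace n) :
    ContDiff ℝ ∞ fun y => fderiv ℝ φ y w :=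
  (hφ.fderiv_right (by simp)).clm_apply contDiff_const

theorem continuous_dirDeriv₂ (hφ : ContDiff ℝ ∞ φ) (v w : CSpace n) :
    Continuous (dirDeriv₂ φ v w) :=
  (contDiff_fderiv_apply (contDiff_fderiv_apply hφ w) v).continuous

theorem tsupport_dirDeriv₂_subset (v w : CSpace n) :
    tsupport (dirDeriv₂ φ v w) ⊆ tsupport φ :=
  (tsupport_fderiv_apply_subset ℝ v).trans (tsupport_fderiv_apply_subset ℝ w)

theorem continuous_hessianDensity (hn : 0 < n) (m : ℕ) (α : Fin n → Matrix (Fin n) (Fin n) ℂ)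
    (hφ : ContDiff ℝ ∞ φ) : Continuous (hessianDensity m α φ) := by
  obtain ⟨a, b, h⟩ := exists_hessianDensity_eq_sum hn m α
  rw [funext (h φ)]
  simp only [complexHessian_re, complexHessian_im]
  have := continuous_dirDeriv₂ hφ
  fun_prop

theorem hessianDensity_eq_zero (hn : 0 < n) (m : ℕ) (α : Fin n → Matrix (Fin n) (Fin n) ℂ)
    {z : CSpace n} (hz : z ∉ tsupport φ) : hessianDensity m α φ z = 0 := by
  obtain ⟨a, b, h⟩ := exists_hessianDensity_eq_sum hn m α
  have h0 : ∀ v w, dirDeriv₂ φ v w z = 0 := fun v w =>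
    image_eq_zero_of_notMem_tsupport fun hz' => hz (tsupport_dirDeriv₂_subset v w hz')
  simp [h, complexHessian_re, complexHessian_im, h0]

theorem integrable_mul_hessianDensity (hn : 0 < n) (m : ℕ)
    (α : Fin n → Matrix (Fin n) (Fin n) ℂ) (hφ : ContDiff ℝ ∞ φ) (hc : HasCompactSupport φ)
    {U : Set (CSpace n)} {u : CSpace n → ℝ} (hu : ContinuousOn u U) (hU : tsupport φ ⊆ U) :
    Integrable fun z => u z * hessianDensity m α φ z := by
  have hon : IntegrableOn (fun z => u z * hessianDensity m α φ z) (tsupport φ) :=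
    ((hu.mono hU).mul (continuous_hessianDensity hn m α hφ).continuousOn).integrableOn_compact hc
  refine (integrableOn_iff_integrable_of_support_subset fun z hz => ?_).1 hon
  by_contra h
  exact hz (by simp [hessianDensity_eq_zero hn m α h])

theorem integral_fderiv_apply_eq_zero (hφ : ContDiff ℝ ∞ φ) (hc : HasCompactSupport φ)
    (w : CSpace n) : ∫ z, fderiv ℝ φ z w = 0 := by
  have hi : Integrable fun z => fderiv ℝ φ z w :=
    (contDiff_fderiv_apply hφ w).continuous.integrable_of_hasCompactSupport (hc.fderiv_apply ℝ w)
  have := integral_mul_fderiv_eq_neg_fderiv_mul_of_integrable (μ := (volume : Measure (CSpace n)))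
    (f := fun _ => (1 : ℝ)) (g := φ) (v := w)
    (by simp) (by simpa using hi)
    (by simpa using hφ.continuous.integrable_of_hasCompactSupport hc)
    (fun _ _ => by fun_prop) (fun _ _ => hφ.differentiable (by simp) _)
  simpa using this

theorem integrable_mul_dirDeriv₂ (hφ : ContDiff ℝ ∞ φ) (hc : HasCompactSupport φ)
    {u : CSpace n → ℝ} (hu : Continuous u) (v w : CSpace n) :
    Integrable fun z => u z * dirDeriv₂ φ v w z :=
  (hu.mul (continuous_dirDeriv₂ hφ v w)).integrable_of_hasCompactSupport
    (((hc.fderiv_apply ℝ w).fderiv_apply ℝ v).mul_left)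

/-- Integrating by parts moves `∂_v` onto the affine factor and leaves the constant `l v` times the
integral of a derivative of a test function, which vanishes. -/
theorem integral_affine_mul_dirDeriv₂ (hφ : ContDiff ℝ ∞ φ) (hc : HasCompactSupport φ)
    (l : CSpace n →L[ℝ] ℝ) (c : ℝ) (v w : CSpace n) :
    ∫ z, (l z + c) * dirDeriv₂ φ v w z = 0 := by
  have hφw := contDiff_fderiv_apply hφ w
  have hcw := hc.fderiv_apply ℝ w
  have hfd : ∀ z, fderiv ℝ (fun z => l z + c) z v = l v := fun z => by
    rw [fderiv_add_const]; simp
  have := integral_mul_fderiv_eq_neg_fderiv_mul_of_integrable (μ := (volume : Measure (CSpace n)))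
    (f := fun z => l z + c) (g := fun y => fderiv ℝ φ y w) (v := v)
    (by simp only [hfd]
        exact (hφw.continuous.integrable_of_hasCompactSupport hcw).const_mul _)
    (integrable_mul_dirDeriv₂ hφ hc (by fun_prop) v w)
    (((by fun_prop : Continuous fun z => l z + c).mul
      hφw.continuous).integrable_of_hasCompactSupport hcw.mul_left)
    (fun _ _ => by fun_prop) (fun _ _ => hφw.differentiable (by simp) _)
  simp only [hfd, integral_const_mul, integral_fderiv_apply_eq_zero hφ hc] at this
  simpa [dirDeriv₂] using this

theorem integral_affine_mul_hessianDensity (hn : 0 < n) (m : ℕ)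
    (α : Fin n → Matrix (Fin n) (Fin n) ℂ) (hφ : ContDiff ℝ ∞ φ) (hc : HasCompactSupport φ)
    (l : CSpace n →L[ℝ] ℝ) (c : ℝ) :
    ∫ z, (l z + c) * hessianDensity m α φ z = 0 := by
  obtain ⟨a, b, h⟩ := exists_hessianDensity_eq_sum hn m α
  have hD : ∀ v w, ∫ z, (l z + c) * dirDeriv₂ φ v w z = 0 :=
    integral_affine_mul_dirDeriv₂ hφ hc l c
  have hI : ∀ v w, Integrable fun z => (l z + c) * dirDeriv₂ φ v w z :=
    integrable_mul_dirDeriv₂ hφ hc (by fun_prop)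
  have hR : ∀ j k, Integrable (fun z => (l z + c) * (complexHessian φ z j k).re) ∧
      ∫ z, (l z + c) * (complexHessian φ z j k).re = 0 := fun j k => by
    simp only [complexHessian_re, mul_left_comm _ (1 / 4 : ℝ), mul_add (l _ + c)]
    refine ⟨((hI _ _).add (hI _ _)).const_mul _, ?_⟩
    rw [integral_const_mul, integral_add (hI _ _) (hI _ _), hD, hD]; simp
  have hJ : ∀ j k, Integrable (fun z => (l z + c) * (complexHessian φ z j k).im) ∧
      ∫ z, (l z + c) * (complexHessian φ z j k).im = 0 := fun j k => by
    simp only [complexHessian_im, mul_left_comm _ (1 / 4 : ℝ), mul_sub (l _ + c)]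
    refine ⟨((hI _ _).sub (hI _ _)).const_mul _, ?_⟩
    rw [integral_const_mul, integral_sub (hI _ _) (hI _ _), hD, hD]; simp
  have hRJ : ∀ j k, Integrable (fun z => a j k * ((l z + c) * (complexHessian φ z j k).re) +
      b j k * ((l z + c) * (complexHessian φ z j k).im)) := fun j k =>
    ((hR j k).1.const_mul _).add ((hJ j k).1.const_mul _)
  simp only [h, Finset.mul_sum, mul_add (l _ + c), mul_left_comm (l _ + c)]
  rw [integral_finsetSum _ fun j _ => integrable_finsetSum _ fun k _ => hRJ j k]
  refine Finset.sum_eq_zero fun j _ => ?_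
  rw [integral_finsetSum _ fun k _ => hRJ j k]
  refine Finset.sum_eq_zero fun k _ => ?_
  rw [integral_add ((hR j k).1.const_mul _) ((hJ j k).1.const_mul _), integral_const_mul,
    integral_const_mul, (hR j k).2, (hJ j k).2]
  simp

end TestFunctions

/-! ### Affine functions are m-subharmonic -/

/-- The mean of a real-affine function over a ball is its value at the centre. -/
theorem average_ball_affine (l : CSpace n →L[ℝ] ℝ) (c : ℝ) (a : CSpace n) {r : ℝ} (hr : 0 < r) :
    ⨍ x in Metric.ball a r, (l x + c) = l a + c := by
  have hint : ∀ f : CSpace n → ℝ, Continuous f → IntegrableOn f (Metric.ball a r) := fun f hf =>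
    (hf.continuousOn.integrableOn_compact (isCompact_closedBall a r)).mono_set
      Metric.ball_subset_closedBall
  have h0 : ∫ x in Metric.ball a r, l (x - a) = 0 := by
    have h1 : ∫ x in Metric.ball a r, l (x - a) = ∫ x in Metric.ball (0 : CSpace n) r, l x := by
      rw [← integral_indicator measurableSet_ball, ← integral_indicator measurableSet_ball,
        ← integral_sub_right_eq_self (fun x => (Metric.ball (0 : CSpace n) r).indicator l x) a]
      congr 1; ext x
      simp [Set.indicator, dist_eq_norm]
    -- The reflection `x ↦ -x` preserves the centred ball and changes the sign of `l`.
    have h2 : ∫ x in Metric.ball (0 : CSpace n) r, l x =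
        -∫ x in Metric.ball (0 : CSpace n) r, l x := by
      rw [← integral_neg, ← integral_indicator measurableSet_ball,
        ← integral_indicator measurableSet_ball,
        ← integral_neg_eq_self (fun x => (Metric.ball (0 : CSpace n) r).indicator l x)]
      congr 1; ext x
      simp [Set.indicator]
    rw [h1]; linarith
  have h2 : ∫ x in Metric.ball a r, (l x + c) = ∫ _ in Metric.ball a r, (l a + c) := by
    rw [← sub_eq_zero, ← integral_sub (hint _ (by fun_prop)) (hint _ (by fun_prop)), ← h0]
    congr 1; ext x; simp
  rw [average_eq, h2, ← average_eq]
  exact setAverage_const (Metric.measure_ball_pos _ _ hr).ne' measure_ball_lt_top.ne _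

theorem isMSubharmonicOn_affine (hn : 0 < n) (m : ℕ) (l : CSpace n →L[ℝ] ℝ) (c : ℝ) :
    IsMSubharmonicOn m (fun z => l z + c) Set.univ where
  subharmonic :=
    { usc := (by fun_prop : Continuous fun z => l z + c).upperSemicontinuous.upperSemicontinuousOn _
      locInt := ((by fun_prop : Continuous fun z => l z + c).locallyIntegrable).locallyIntegrableOn _
      submean := fun a _ hr _ => (average_ball_affine l c a hr).ge }
  current_nonneg := fun α _ _ hφ hc _ _ => (integral_affine_mul_hessianDensity hn m α hφ hc l c).ge

/-! ### Convex cone structure of `SHo m X` -/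

section Cone

variable {X : Set (CSpace n)}

theorem affine_mem_SHo (hn : 0 < n) (m : ℕ) (X : Set (CSpace n)) (l : CSpace n →L[ℝ] ℝ) (c : ℝ) :
    (fun x : X => l x + c) ∈ SHo m X :=
  ⟨Set.univ, fun z => l z + c, isOpen_univ, Set.subset_univ _, isMSubharmonicOn_affine hn m l c,
    by fun_prop, fun _ => rfl⟩

theorem continuous_of_mem_SHo {f : X → ℝ} (hf : f ∈ SHo m X) : Continuous f := by
  obtain ⟨U, u, _, hXU, _, hc, hfu⟩ := hf
  rw [funext hfu]
  exact (hc.mono hXU).domRestrict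

theorem add_mem_SHo (hn : 0 < n) {f g : X → ℝ} (hf : f ∈ SHo m X) (hg : g ∈ SHo m X) :
    f + g ∈ SHo m X := by
  obtain ⟨U, u, hU, hXU, hu, huc, hfu⟩ := hf
  obtain ⟨V, v, hV, hXV, hv, hvc, hgv⟩ := hg
  have huc' := huc.mono (Set.inter_subset_left (s := U) (t := V))
  have hvc' := hvc.mono (Set.inter_subset_right (s := U) (t := V))
  refine ⟨U ∩ V, u + v, hU.inter hV, Set.subset_inter hXU hXV, ⟨⟨?_, ?_, ?_⟩, ?_⟩, huc'.add hvc',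
    fun x => by simp [hfu, hgv]⟩
  · exact (huc'.add hvc').upperSemicontinuousOn
  · exact (hu.subharmonic.locInt.mono_set Set.inter_subset_left).add
      (hv.subharmonic.locInt.mono_set Set.inter_subset_right)
  · intro a r hr hsub
    have hint : ∀ f : CSpace n → ℝ, ContinuousOn f (U ∩ V) →
        IntegrableOn f (Metric.ball a r) := fun f hf =>
      ((hf.mono hsub).integrableOn_compact (isCompact_closedBall a r)).mono_set
        Metric.ball_subset_closedBall
    have h1 := hu.subharmonic.submean a r hr (hsub.trans Set.inter_subset_left)
    have h2 := hv.subharmonic.submean a r hr (hsub.trans Set.inter_subset_right)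
    rw [setAverage_eq] at h1 h2 ⊢
    simp only [Pi.add_apply]
    rw [integral_add (hint u huc') (hint v hvc'), smul_add]
    exact add_le_add h1 h2
  · intro α hα φ hφ hc hs h0
    simp only [Pi.add_apply, add_mul]
    rw [integral_add (integrable_mul_hessianDensity hn m α hφ hc huc' hs)
      (integrable_mul_hessianDensity hn m α hφ hc hvc' hs)]
    exact add_nonneg (hu.current_nonneg α hα φ hφ hc (hs.trans Set.inter_subset_left) h0)
      (hv.current_nonneg α hα φ hφ hc (hs.trans Set.inter_subset_right) h0)

theorem const_mul_mem_SHo {f : X → ℝ} (hf : f ∈ SHo m X) {c : ℝ} (hc : 0 ≤ c) :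
    (fun x => c * f x) ∈ SHo m X := by
  obtain ⟨U, u, hU, hXU, hu, huc, hfu⟩ := hf
  refine ⟨U, fun z => c * u z, hU, hXU, ⟨⟨?_, ?_, ?_⟩, ?_⟩, huc.const_mul c,
    fun x => by simp [hfu]⟩
  · exact (huc.const_mul c).upperSemicontinuousOn
  · exact hu.subharmonic.locInt.smul c
  · intro a r hr hsub
    have h1 := hu.subharmonic.submean a r hr hsub
    rw [setAverage_eq] at h1 ⊢
    rw [integral_const_mul, smul_eq_mul, mul_left_comm]
    exact mul_le_mul_of_nonneg_left h1 hc
  · intro α hα φ hφ hcs hs h0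
    simp only [mul_assoc]
    rw [integral_const_mul]
    exact mul_nonneg hc (hu.current_nonneg α hα φ hφ hcs hs h0)

end Cone

variable {X : Set (CSpace n)}

/-! ### Absorbing sets and the maximum principle -/

/-- Every Jensen measure of a point of an absorbing set is carried by that set. -/
def IsAbsorbing (m : ℕ) (A : Set X) : Prop :=
  ∀ z ∈ A, ∀ μ ∈ jensen m X z, μ Aᶜ = 0

/-- The maximum set of a function of the cone on a closed absorbing set is absorbing. -/
theorem IsAbsorbing.inter_argmax [CompactSpace X] {A : Set X} (hA : IsAbsorbing m A)
    {f : X → ℝ} (hf : f ∈ SHo m X) : IsAbsorbing m {x ∈ A | ∀ y ∈ A, f y ≤ f x} := by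
  rintro z ⟨hz, hmax⟩ μ hμ
  have hA0 := hA z hz μ hμ
  obtain ⟨_, hp, hJ⟩ := hμ
  have hint : Integrable f μ :=
    (continuous_of_mem_SHo hf).integrable_of_hasCompactSupport (.of_compactSpace f)
  have hae : ∀ᵐ x ∂μ, x ∈ A := hA0
  have hnn : 0 ≤ᵐ[μ] fun x => f z - f x := by
    filter_upwards [hae] with x hx using sub_nonneg.2 (hmax x hx)
  -- The Jensen inequality opposes the a.e. bound `f ≤ f z` on `A`, so `f = f z` almost everywhere.
  have hle : ∫ x, (f z - f x) ∂μ ≤ 0 := by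
    rw [integral_sub (integrable_const _) hint]
    simpa using hJ f hf
  have h0 := (integral_eq_zero_iff_of_nonneg_ae hnn ((integrable_const _).sub hint)).1
    (hle.antisymm (integral_nonneg_of_ae hnn))
  have hgoal : ∀ᵐ x ∂μ, x ∈ {x ∈ A | ∀ y ∈ A, f y ≤ f x} := by
    filter_upwards [hae, h0] with x hx hx0
    refine ⟨hx, fun y hy => ?_⟩
    have : f z - f x = 0 := hx0
    linarith [hmax y hy]
  exact hgoal

/-- Passing to the argmax set of each function in turn makes that function constant, and earlier
ones stay constant on subsets. Compactness keeps every stage nonempty. -/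
theorem exists_isAbsorbing_subset [CompactSpace X] {A : Set X} (hA : IsAbsorbing m A)
    (hAc : IsClosed A) (hne : A.Nonempty) (s : Finset (X → ℝ)) (hs : ∀ f ∈ s, f ∈ SHo m X) :
    ∃ A' ⊆ A, IsAbsorbing m A' ∧ IsClosed A' ∧ A'.Nonempty ∧
      ∀ f ∈ s, ∀ x ∈ A', ∀ y ∈ A', f x = f y := by
  classical
  induction s using Finset.induction_on with
  | empty => exact ⟨A, subset_rfl, hA, hAc, hne, by simp⟩
  | insert f s _ ih =>
    obtain ⟨B, hBA, hB, hBc, hBne, hBs⟩ := ih fun g hg => hs g (Finset.mem_insert_of_mem hg)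
    have hf := hs f (Finset.mem_insert_self f s)
    have hfc := continuous_of_mem_SHo hf
    obtain ⟨x₀, hx₀, hmax⟩ := hBc.isCompact.exists_isMaxOn hBne hfc.continuousOn
    refine ⟨{x ∈ B | ∀ y ∈ B, f y ≤ f x}, (Set.sep_subset _ _).trans hBA, hB.inter_argmax hf, ?_,
      ⟨x₀, hx₀, fun y hy => hmax hy⟩, fun g hg x hx y hy => ?_⟩
    · have : {x ∈ B | ∀ y ∈ B, f y ≤ f x} = B ∩ ⋂ y ∈ B, {x | f y ≤ f x} := by ext; simp
      rw [this]
      exact hBc.inter (isClosed_biInter fun y _ => isClosed_le continuous_const hfc)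
    · rcases Finset.mem_insert.1 hg with rfl | hg
      · exact (hy.2 x hx.1).antisymm (hx.2 y hy.1)
      · exact hBs g hg x hx.1 y hy.1

theorem dirac_mem_jensen [CompactSpace X] (m : ℕ) (z : X) : Measure.dirac z ∈ jensen m X z := by
  refine ⟨inferInstance, inferInstance, fun u _ => ?_⟩
  rw [integral_dirac]

theorem mem_choquetBoundary_of_isAbsorbing_singleton [CompactSpace X] {z : X} (h : IsAbsorbing m {z}) :
    z ∈ choquetBoundary m X := by
  refine Set.eq_singleton_iff_unique_mem.2 ⟨dirac_mem_jensen m z, fun μ hμ => ?_⟩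
  have h0 := h z rfl μ hμ
  have := hμ.2.1
  have hae : ∀ᵐ x ∂μ, x = z := h0
  ext s hs
  rw [Measure.dirac_apply' z hs]
  by_cases hz : z ∈ s
  · rw [Set.indicator_of_mem hz, Pi.one_apply, ← prob_compl_eq_zero_iff hs]
    exact measure_mono_null (fun x hx (hxz : x = z) => hx (hxz ▸ hz)) h0
  · rw [Set.indicator_of_notMem hz]
    exact measure_mono_null (fun x hx (hxz : x = z) => hz (hxz ▸ hx)) h0

/-- Bauer's maximum principle: the functions in `SH_m^o(X)` attain their maximum on the Choquet
boundary. -/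
theorem exists_mem_choquetBoundary_forall_le [CompactSpace X] [Nonempty X] (hn : 0 < n)
    {f : X → ℝ} (hf : f ∈ SHo m X) : ∃ z ∈ choquetBoundary m X, ∀ y, f y ≤ f z := by
  classical
  have huniv : IsAbsorbing m (Set.univ : Set X) := fun z _ μ _ => by simp
  let re : Fin n → X → ℝ := fun j x => (Complex.reCLM ∘L
    (EuclideanSpace.proj j : CSpace n →L[ℂ] ℂ).restrictScalars ℝ) x + 0
  let im : Fin n → X → ℝ := fun j x => (Complex.imCLM ∘L
    (EuclideanSpace.proj j : CSpace n →L[ℂ] ℂ).restrictScalars ℝ) x + 0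
  obtain ⟨x₀, -, hmax⟩ := isCompact_univ.exists_isMaxOn Set.univ_nonempty
    (continuous_of_mem_SHo hf).continuousOn
  obtain ⟨A, hAm, hA, -, ⟨z, hz⟩, hAs⟩ := exists_isAbsorbing_subset (huniv.inter_argmax hf)
    (by
      have : {x ∈ (Set.univ : Set X) | ∀ y ∈ Set.univ, f y ≤ f x} = ⋂ y, {x | f y ≤ f x} := by
        ext; simp
      rw [this]
      exact isClosed_iInter fun y => isClosed_le continuous_const (continuous_of_mem_SHo hf))
    ⟨x₀, trivial, fun y hy => hmax hy⟩ (Finset.univ.image re ∪ Finset.univ.image im)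
    (by
      intro g hg
      rcases Finset.mem_union.1 hg with hg | hg <;>
      · obtain ⟨j, -, rfl⟩ := Finset.mem_image.1 hg
        exact affine_mem_SHo hn m X _ 0)
  -- All real and imaginary parts of the coordinates are constant on `A`, and they separate points.
  have hAz : A = {z} := by
    refine Set.eq_singleton_iff_unique_mem.2 ⟨hz, fun x hx => ?_⟩
    ext j
    apply Complex.ext
    · simpa [re] using hAs (re j) (by simp) x hx z hz
    · simpa [im] using hAs (im j) (by simp) x hx z hz
  exact ⟨z, mem_choquetBoundary_of_isAbsorbing_singleton (hAz ▸ hA), fun y => (hAm hz).2 y trivial⟩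

theorem const_mem_SHo (hn : 0 < n) (c : ℝ) : (fun _ : X => c) ∈ SHo m X := by
  simpa using affine_mem_SHo hn m X 0 c

/-! ### Jensen measures carried by a closed boundary -/

/-- The infimum at `z` of the functions `w` with `-w` in the cone and `w ≥ f` on `B`. -/
noncomputable def upperEnvelope (m : ℕ) (B : Set X) (z : X) (f : C(X, ℝ)) : ℝ :=
  sInf {t | ∃ u ∈ SHo m X, (∀ x ∈ B, u x + f x ≤ 0) ∧ t = -u z}

section Envelope

variable {B : Set X}

theorem bddBelow_upperEnvelope [CompactSpace X]
    (hB : ∀ u ∈ SHo m X, ∀ c : ℝ, (∀ x ∈ B, u x ≤ c) → ∀ z, u z ≤ c)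
    (z : X) (f : C(X, ℝ)) :
    BddBelow {t | ∃ u ∈ SHo m X, (∀ x ∈ B, u x + f x ≤ 0) ∧ t = -u z} := by
  refine ⟨-‖f‖, ?_⟩
  rintro _ ⟨u, hu, huf, rfl⟩
  refine neg_le_neg (hB u hu _ (fun x hx => ?_) z)
  have := (abs_le.1 (f.norm_coe_le_norm x)).1
  linarith [huf x hx]

theorem upperEnvelope_le [CompactSpace X]
    (hB : ∀ u ∈ SHo m X, ∀ c : ℝ, (∀ x ∈ B, u x ≤ c) → ∀ z, u z ≤ c)
    {z : X} {f : C(X, ℝ)} {u : X → ℝ} (hu : u ∈ SHo m X)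
    (huf : ∀ x ∈ B, u x + f x ≤ 0) : upperEnvelope m B z f ≤ -u z :=
  csInf_le (bddBelow_upperEnvelope hB z f) ⟨u, hu, huf, rfl⟩

theorem le_upperEnvelope [CompactSpace X] (hn : 0 < n) {z : X} {f : C(X, ℝ)} {t : ℝ}
    (h : ∀ u ∈ SHo m X, (∀ x ∈ B, u x + f x ≤ 0) → t ≤ -u z) : t ≤ upperEnvelope m B z f := by
  refine le_csInf ⟨_, fun _ => -‖f‖, const_mem_SHo hn _, fun x _ => ?_, rfl⟩ ?_
  · have := (abs_le.1 (f.norm_coe_le_norm x)).2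
    linarith
  · rintro _ ⟨u, hu, huf, rfl⟩
    exact h u hu huf

theorem upperEnvelope_add_le [CompactSpace X]
    (hB : ∀ u ∈ SHo m X, ∀ c : ℝ, (∀ x ∈ B, u x ≤ c) → ∀ z, u z ≤ c)
    (hn : 0 < n) (z : X) (f g : C(X, ℝ)) :
    upperEnvelope m B z (f + g) ≤ upperEnvelope m B z f + upperEnvelope m B z g := by
  rw [← sub_le_iff_le_add]
  refine le_upperEnvelope hn fun u hu huf => ?_
  rw [sub_le_comm]
  refine le_upperEnvelope hn fun v hv hvg => ?_
  have := upperEnvelope_le hB (z := z) (f := f + g) (add_mem_SHo hn hu hv) fun x hx => by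
    have := huf x hx
    have := hvg x hx
    simp only [Pi.add_apply, ContinuousMap.add_apply]; linarith
  simp only [Pi.add_apply] at this
  linarith

theorem upperEnvelope_smul [CompactSpace X]
    (hB : ∀ u ∈ SHo m X, ∀ c : ℝ, (∀ x ∈ B, u x ≤ c) → ∀ z, u z ≤ c)
    (hn : 0 < n) (z : X) {c : ℝ} (hc : 0 < c)
    (f : C(X, ℝ)) : upperEnvelope m B z (c • f) = c * upperEnvelope m B z f := by
  have key : ∀ {c : ℝ} (_ : 0 < c) (f : C(X, ℝ)),
      upperEnvelope m B z (c • f) ≤ c * upperEnvelope m B z f := fun {c} hc f => by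
    rw [← div_le_iff₀' hc]
    refine le_upperEnvelope hn fun u hu huf => ?_
    rw [div_le_iff₀' hc]
    have := upperEnvelope_le hB (z := z) (f := c • f) (const_mul_mem_SHo hu hc.le) fun x hx => by
      have := mul_nonpos_of_nonneg_of_nonpos hc.le (huf x hx)
      simpa [mul_add] using this
    simpa using this
  refine (key hc f).antisymm ?_
  have := key (inv_pos.2 hc) (c • f)
  rw [inv_smul_smul₀ hc.ne'] at this
  rwa [le_inv_mul_iff₀ hc] at this

/-- If a closed set is a boundary for the cone then every point has a Jensen measure carried by
it. -/
theorem exists_mem_jensen_compl_eq_zero [CompactSpace X]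
    (hB : ∀ u ∈ SHo m X, ∀ c : ℝ, (∀ x ∈ B, u x ≤ c) → ∀ z, u z ≤ c)
    (hn : 0 < n) (hBc : IsClosed B)
    (hne : B.Nonempty) (z : X) : ∃ μ ∈ jensen m X z, μ Bᶜ = 0 := by
  -- Hahn–Banach from the zero subspace: only domination by the envelope is needed, and homogeneity
  -- with factor 2 gives its value 0 at 0.
  obtain ⟨L, -, hL⟩ := exists_extension_of_le_sublinear (⊥ : C(X, ℝ) →ₗ.[ℝ] ℝ)
    (upperEnvelope m B z) (fun c hc f => upperEnvelope_smul hB hn z hc f)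
    (upperEnvelope_add_le hB hn z) (by
      rintro ⟨f, hf⟩
      obtain rfl : f = 0 := (Submodule.mem_bot ℝ).1 hf
      have := upperEnvelope_smul hB hn z (c := 2) (by norm_num) 0
      rw [smul_zero] at this
      have h0 : upperEnvelope m B z 0 = 0 := by linarith
      rw [h0]
      exact (LinearPMap.map_zero _).le)
  have hLu : ∀ (u : X → ℝ) (f : C(X, ℝ)), u ∈ SHo m X → (∀ x ∈ B, u x + f x ≤ 0) → L f ≤ -u z :=
    fun u f hu huf => (hL f).trans (upperEnvelope_le hB hu huf)
  have hL0 : ∀ f : C(X, ℝ), (∀ x ∈ B, f x ≤ 0) → L f ≤ 0 := fun f hf => by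
    simpa using hLu _ f (const_mem_SHo hn 0) (by simpa using hf)
  let e : CompactlySupportedContinuousMap X ℝ →ₗ[ℝ] C(X, ℝ) :=
    { toFun := fun f => f.toContinuousMap
      map_add' := fun _ _ => rfl
      map_smul' := fun _ _ => rfl }
  let Λ := PositiveLinearMap.mk₀ (L ∘ₗ e) fun f hf => by
    have := hL0 (-(e f)) fun x _ => by simpa [e] using hf x
    simpa using this
  let μ := RealRMK.rieszMeasure Λ
  have hμ : ∀ f : C(X, ℝ), ∫ x, f x ∂μ = L f := fun f =>
    RealRMK.integral_rieszMeasure Λ (CompactlySupportedContinuousMap.continuousMapEquiv f)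
  have hreg : μ.Regular := inferInstance
  have h1 : ∫ _, (1 : ℝ) ∂μ = 1 := by
    refine (hμ 1).trans (le_antisymm ?_ ?_)
    · simpa using hLu _ 1 (const_mem_SHo hn (-1)) (by simp)
    · have := hLu _ (-1) (const_mem_SHo hn 1) (by simp)
      rw [map_neg] at this
      linarith
  have hprob : IsProbabilityMeasure μ := ⟨by
    rw [integral_const, smul_eq_mul, mul_one, Measure.real] at h1
    exact (ENNReal.toReal_eq_one_iff _).1 h1⟩
  refine ⟨μ, ⟨hreg, hprob, fun u hu => ?_⟩, ?_⟩
  · let f : C(X, ℝ) := ⟨u, continuous_of_mem_SHo hu⟩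
    -- Since `u + (-u) ≤ 0`, `u` competes in the envelope of `-u`; domination is then exactly the
    -- Jensen inequality.
    have := hLu u (-f) hu (by simp [f])
    rw [map_neg, ← hμ] at this
    exact neg_le_neg_iff.1 this
  -- The distance to `B` is nonnegative and vanishes on `B`, so its integral is 0 and it vanishes
  -- almost everywhere.
  · let d : C(X, ℝ) := ⟨fun x => Metric.infDist x B, Metric.continuous_infDist_pt B⟩
    have hd : ∫ x, d x ∂μ ≤ 0 := by
      rw [hμ]
      exact hL0 d fun x hx => (Metric.infDist_zero_of_mem hx).le
    have hd0 : 0 ≤ d := fun x => Metric.infDist_nonneg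
    have hae := (integral_eq_zero_iff_of_nonneg hd0
      (d.continuous.integrable_of_hasCompactSupport (.of_compactSpace _))).1
      (hd.antisymm (integral_nonneg hd0))
    have : ∀ᵐ x ∂μ, x ∈ B := by
      filter_upwards [hae] with x hx using (hBc.mem_iff_infDist_zero hne).2 hx
    exact this

end Envelope

/-! ### Harmonic measure and the conclusion -/

theorem harmonicMeasure_le_one (m : ℕ) (z : X) (E : Set X) : harmonicMeasure m X z E ≤ 1 := by
  refine (iInf₂_le Set.univ ⟨isOpen_univ, Set.subset_univ E⟩).trans (iSup₂_le fun μ hμ => ?_)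
  have := hμ.2.1
  exact prob_le_one

theorem harmonicMeasure_eq_one_of_compl_eq_zero {z : X} {E : Set X} {μ : Measure X}
    (hμ : μ ∈ jensen m X z) (h0 : μ Eᶜ = 0) : harmonicMeasure m X z E = 1 := by
  refine (harmonicMeasure_le_one m z E).antisymm (le_iInf₂ fun V hV => ?_)
  have := hμ.2.1
  refine le_trans ?_ (le_iSup₂ (f := fun (μ : Measure X) (_ : μ ∈ jensen m X z) => μ V) μ hμ)
  rw [(prob_compl_eq_zero_iff hV.1.measurableSet).1
    (measure_mono_null (Set.compl_subset_compl.2 hV.2) h0)]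

theorem mem_of_mem_choquetBoundary {z : X} (hz : z ∈ choquetBoundary m X) {E : Set X}
    (hE : harmonicMeasure m X z E = 1) : z ∈ E := by
  by_contra hzE
  have hz' : jensen m X z = {Measure.dirac z} := hz
  have : harmonicMeasure m X z E ≤ 0 := by
    refine (iInf₂_le {z}ᶜ ⟨isOpen_compl_singleton, fun x hx hxz => hzE (hxz ▸ hx)⟩).trans ?_
    simp [hz']
  simp [hE] at this

end MSubharmonic

theorem mainTheorem5 (n m : ℕ) (hm : 1 ≤ m) (hmn : m ≤ n)
    (X : Set (EuclideanSpace ℂ (Fin n))) (hX : IsCompact X) :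
    IsLeast {E : Set X | IsClosed E ∧ ∀ z : X, MSubharmonic.harmonicMeasure m X z E = 1}
      (MSubharmonic.silovBoundary m X) := by
  have hn : 0 < n := hm.trans hmn
  have : CompactSpace X := isCompact_iff_compactSpace.1 hX
  refine ⟨⟨isClosed_closure, fun z => ?_⟩, fun E hE => closure_minimal
    (fun z hz => MSubharmonic.mem_of_mem_choquetBoundary hz (hE.2 z)) hE.1⟩
  have : Nonempty X := ⟨z⟩
  -- The maximum principle for the constant 0 shows that the Choquet boundary is nonempty.
  obtain ⟨x, hx, -⟩ := MSubharmonic.exists_mem_choquetBoundary_forall_le hn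
    (MSubharmonic.const_mem_SHo (m := m) (X := X) hn 0)
  obtain ⟨μ, hμ, h0⟩ := MSubharmonic.exists_mem_jensen_compl_eq_zero
    (B := MSubharmonic.silovBoundary m X) (fun u hu c huc z => by
      obtain ⟨y, hy, hmax⟩ := MSubharmonic.exists_mem_choquetBoundary_forall_le hn hu
      exact (hmax z).trans (huc y (subset_closure hy))) hn isClosed_closure
    ⟨x, subset_closure hx⟩ z
  exact MSubharmonic.harmonicMeasure_eq_one_of_compl_eq_zero hμ h0
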